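/- Let $G=(V,E)$ be a finite simple graph with $n$ vertices. A labeling of $G$ is a bijection $\sigma\colon V\to\{1,\dots,n\}$; let $\Lambda_G$ be the set of labelings of $G$. For $1\le i\le n-1$, let $\tau_i\colon\Lambda_G\to\Lambda_G$ be the toggle operator given by $\tau_i(\sigma)=(i\;\,i{+}1)\circ\sigma$ if $\{\sigma^{-1}(i),\sigma^{-1}(i+1)\}\notin E$, and $\tau_i(\sigma)=\sigma$ otherwise. Let $\mathrm{Pro}=\tau_{n-1}\cdots\tau_2\tau_1$ (promotion, with $\tau_1$ applied first), and let $c\colon\Lambda_G\to\Lambda_G$ be the operator $c(\sigma)=(1\;2\;\cdots\;n)\circ\sigma$, which cyclically shifts the labels. If $G$ is a tree, then every orbit of the bijection $c\,\mathrm{Pro}\colon\Lambda_G\to\Lambda_G$ has size exactly $n$. -/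

import Mathlib

/-- A labeling of a graph with vertex set `V` and `n` vertices: a bijection from `V` to the set of
labels. The label written `k` in the interval `1, …, n` is the element `k - 1` of `Fin n`. -/
abbrev Labeling (V : Type*) (n : ℕ) : Type _ := V ≃ Fin n

open Classical in
/-- The effect of the toggle at labels `i` and `j` on one labeling: swap the labels `i` and `j` if
they sit on nonadjacent vertices, and do nothing otherwise. -/
noncomputable def toggleFun {V : Type*} (G : SimpleGraph V) {n : ℕ} (i j : Fin n)
    (σ : Labeling V n) : Labeling V n :=
  if G.Adj (σ.symm i) (σ.symm j) then σ else σ.trans (Equiv.swap i j)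

theorem toggleFun_involutive {V : Type*} (G : SimpleGraph V) {n : ℕ} (i j : Fin n) :
    Function.Involutive (toggleFun G i j) := by
  intro σ
  by_cases h : G.Adj (σ.symm i) (σ.symm j)
  · simp [toggleFun, h]
  · have h' : ¬ G.Adj (σ.symm j) (σ.symm i) := fun k => h k.symm
    ext v
    simp [toggleFun, h, h']

/-- The toggle operator, as a permutation of the set of labelings. -/
noncomputable def toggle {V : Type*} (G : SimpleGraph V) {n : ℕ} (i j : Fin n) :
    Equiv.Perm (Labeling V n) :=
  (toggleFun_involutive G i j).toPerm

/-- Promotion: the composition `τ_{n-1} ⋯ τ_2 τ_1` (with `τ_1` applied first), where `τ_k` is the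
toggle at the consecutive labels `k` and `k + 1`. Multiplication of permutations is composition,
the right factor acting first. -/
noncomputable def promotion {V : Type*} (G : SimpleGraph V) (n : ℕ) :
    Equiv.Perm (Labeling V n) :=
  ((List.finRange (n - 1)).map fun k =>
    toggle G (⟨k.1, by omega⟩ : Fin n) (⟨k.1 + 1, by omega⟩ : Fin n)).reverse.prod

/-- The cyclic shift of labels `σ ↦ c ∘ σ`, where `c` is the long cycle `(1 2 ⋯ n)`. -/
def cyclicShift (V : Type*) (n : ℕ) : Equiv.Perm (Labeling V n) where
  toFun σ := σ.trans (finRotate n)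
  invFun σ := σ.trans (finRotate n).symm
  left_inv σ := Equiv.ext fun v => (finRotate n).symm_apply_apply (σ v)
  right_inv σ := Equiv.ext fun v => (finRotate n).apply_symm_apply (σ v)

/-!
Let `n = k + 2`. The vertex with the smallest label is regarded as a *carrier*, and the other
`k + 1` vertices as contents of slots arranged in a cycle. Promotion pushes the carrier past the
slots one after the other; when it meets a neighbor, the corresponding toggle does nothing, which
means that the neighbor becomes the carrier and the old carrier stays in the slot. After the cyclic
shift the slots have their old labels again. Hence `c * Pro` is one full round of the process `scan`,
in which a pointer runs through the slots and the carrier is exchanged with the content of the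
current slot whenever the two are adjacent (`cyclicShift_mul_promotion_pow_apply`).

In a forest, along each cycle of `scan` every pair (vertex in the component of the carrier, slot)
occurs exactly once as (carrier, pointer); this is `visitsOnce_of_isAcyclic`. It is proved by
deleting an edge `p w` at the carrier. Without this edge, `w` waits in a fixed slot while the
carrier is in the component of `p`, so this slot is inspected by `p` exactly once per cycle.
Restoring the edge exchanges the successors of this state and of its mirror image, in which `w`
inspects the slot of `p`, and so it joins the two cycles into one (`setOf_sameCycle_eq_union`).

For a tree, the states of a cycle with pointer at the first slot therefore correspond to the
vertices, and they are the elements of an orbit of `c * Pro`.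
-/

/-! ### Merging two cycles of a permutation -/

section CycleMerging

variable {X : Type*} [Finite X]

/-- A forward-invariant set contains every cycle it meets; finiteness makes the negative powers
redundant. -/
theorem Equiv.Perm.SameCycle.mem_of_mapsTo {f : Equiv.Perm X} {C : Set X} {x z : X}
    (h : f.SameCycle x z) (hC : ∀ a ∈ C, f a ∈ C) (hx : x ∈ C) : z ∈ C := by
  obtain ⟨i, -, -, rfl⟩ := h.exists_pow_eq''
  clear h
  induction i with
  | zero => simpa using hx
  | succ i ih => rw [pow_succ', Equiv.Perm.mul_apply]; exact hC _ ih

/-- Two cycles of `f` are merged into one when `g` is obtained from `f` by exchanging the images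
of a point `x` of the first cycle and a point `y` of the second. -/
theorem setOf_sameCycle_eq_union {f g : Equiv.Perm X} {x y : X}
    (hx : g x = f y) (hy : g y = f x)
    (hgx : ∀ z, f.SameCycle x z → z ≠ x → g z = f z)
    (hgy : ∀ z, f.SameCycle y z → z ≠ y → g z = f z) :
    {z | g.SameCycle x z} = {z | f.SameCycle x z} ∪ {z | f.SameCycle y z} := by
  have key : ∀ z, f.SameCycle x z ∨ f.SameCycle y z → z ≠ x → z ≠ y → g z = f z := by
    rintro z (h | h) h1 h2
    exacts [hgx z h h1, hgy z h h2]
  -- Otherwise the `f`-cycle of `y` never leaves the `g`-cycle of `x` after `f y = g x`.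
  have hyC : g.SameCycle x y := by
    by_contra hyC
    have : y ∈ {z | f.SameCycle y z ∧ g.SameCycle x z} := by
      refine Equiv.Perm.SameCycle.mem_of_mapsTo (f := f) (x := f y)
        (by simp [Equiv.Perm.SameCycle.refl]) ?_ ?_
      · rintro a ⟨ha1, ha2⟩
        refine ⟨by simpa using ha1, ?_⟩
        have h1 : a ≠ y := by rintro rfl; exact hyC ha2
        rw [← hgy a ha1 h1]
        simpa using ha2
      · refine ⟨by simp [Equiv.Perm.SameCycle.refl], ?_⟩
        rw [← hx]; simp [Equiv.Perm.SameCycle.refl]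
    exact hyC this.2
  ext z
  constructor
  · intro hz
    refine Equiv.Perm.SameCycle.mem_of_mapsTo hz ?_ (Or.inl (Equiv.Perm.SameCycle.refl f x))
    rintro a ha
    by_cases h1 : a = x
    · subst h1; rw [hx]; right; simp [Equiv.Perm.SameCycle.refl]
    by_cases h2 : a = y
    · subst h2; rw [hy]; left; simp [Equiv.Perm.SameCycle.refl]
    rw [key a ha h1 h2]
    simpa using ha
  · have hstep : ∀ a ∈ {z | (f.SameCycle x z ∨ f.SameCycle y z) ∧ g.SameCycle x z},
        f a ∈ {z | (f.SameCycle x z ∨ f.SameCycle y z) ∧ g.SameCycle x z} := by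
      rintro a ⟨ha, hg⟩
      refine ⟨by simpa using ha, ?_⟩
      by_cases h1 : a = x
      · subst h1; rw [← hy]; simpa using hyC
      by_cases h2 : a = y
      · subst h2; rw [← hx]; simp [Equiv.Perm.SameCycle.refl]
      rw [← key a ha h1 h2]
      simpa using hg
    rintro (hz | hz)
    · exact (Equiv.Perm.SameCycle.mem_of_mapsTo hz hstep
        ⟨Or.inl (.refl f x), .refl g x⟩).2
    · exact (Equiv.Perm.SameCycle.mem_of_mapsTo hz hstep ⟨Or.inr (.refl f y), hyC⟩).2

end CycleMerging

/-! ### The scanning process -/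

section Scan

variable {V : Type*} {k : ℕ}

/-- Toggling with respect to the complement graph exchanges two labels exactly when they sit on
adjacent vertices. -/
theorem toggle_compl_of_adj {G : SimpleGraph V} {n : ℕ} {i j : Fin n} {σ : Labeling V n}
    (h : G.Adj (σ.symm i) (σ.symm j)) : toggle Gᶜ i j σ = σ.trans (Equiv.swap i j) := by
  simp [toggle, toggleFun, h]

theorem toggle_compl_of_not_adj {G : SimpleGraph V} {n : ℕ} {i j : Fin n} (hij : i ≠ j)
    {σ : Labeling V n} (h : ¬ G.Adj (σ.symm i) (σ.symm j)) : toggle Gᶜ i j σ = σ := by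
  simp [toggle, toggleFun, h, hij]

/-- One step of the scanning process. In a state `(σ, q)` the label `0` marks the carrier, the
label `q.succ` marks the content of slot `q`, and `q` is the slot to be inspected next. The carrier
and the content of slot `q` trade places if they are adjacent in `G` (which is what the toggle of
the complement graph does), and the pointer advances cyclically. -/
noncomputable def scan (G : SimpleGraph V) (k : ℕ) :
    Equiv.Perm (Labeling V (k + 2) × Fin (k + 1)) where
  toFun x := (toggle Gᶜ 0 x.2.succ x.1, x.2 + 1)
  invFun x := ((toggle Gᶜ 0 (x.2 - 1).succ)⁻¹ x.1, x.2 - 1)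
  left_inv x := by simp
  right_inv x := by simp

/-- The vertex with label `0`, which belongs to no slot. -/
def carrier {k : ℕ} (x : Labeling V (k + 2) × Fin (k + 1)) : V := x.1.symm 0

theorem scan_of_adj {G : SimpleGraph V} {x : Labeling V (k + 2) × Fin (k + 1)}
    (h : G.Adj (carrier x) (x.1.symm x.2.succ)) :
    scan G k x = (x.1.trans (Equiv.swap 0 x.2.succ), x.2 + 1) :=
  Prod.ext (toggle_compl_of_adj h) rfl

theorem scan_of_not_adj {G : SimpleGraph V} {x : Labeling V (k + 2) × Fin (k + 1)}
    (h : ¬ G.Adj (carrier x) (x.1.symm x.2.succ)) : scan G k x = (x.1, x.2 + 1) :=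
  Prod.ext (toggle_compl_of_not_adj (Fin.succ_ne_zero _).symm h) rfl

theorem scan_pow_snd (G : SimpleGraph V) (x : Labeling V (k + 2) × Fin (k + 1)) (j : ℕ) :
    (((scan G k ^ j) x).2 : ℕ) = (x.2 + j) % (k + 1) := by
  induction j with
  | zero => simp [Nat.mod_eq_of_lt x.2.2]
  | succ j ih =>
    rw [pow_succ', Equiv.Perm.mul_apply]
    change ((((scan G k ^ j) x).2 + 1 : Fin (k + 1)) : ℕ) = _
    rw [Fin.val_add, ih]
    simp [add_assoc]

/-- Vertices outside the connected component of the carrier are never moved. -/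
theorem scan_invariant [Finite V] {G : SimpleGraph V} {x z : Labeling V (k + 2) × Fin (k + 1)}
    (h : (scan G k).SameCycle x z) :
    G.Reachable (carrier x) (carrier z) ∧
      ∀ u, ¬ G.Reachable (carrier x) u → z.1 u = x.1 u := by
  refine h.mem_of_mapsTo (C := {z | G.Reachable (carrier x) (carrier z) ∧
      ∀ u, ¬ G.Reachable (carrier x) u → z.1 u = x.1 u}) ?_ ⟨.refl _, fun _ _ => rfl⟩
  rintro a ⟨h1, h2⟩
  by_cases hadj : G.Adj (carrier a) (a.1.symm a.2.succ)
  · rw [scan_of_adj hadj]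
    refine ⟨?_, fun u hu => ?_⟩
    · simpa [carrier] using h1.trans hadj.reachable
    · rw [← h2 u hu]
      refine Equiv.swap_apply_of_ne_of_ne ?_ ?_
      · intro h0
        apply hu
        rwa [← (Equiv.symm_apply_eq a.1).2 h0.symm]
      · intro h0
        apply hu
        rw [← (Equiv.symm_apply_eq a.1).2 h0.symm]
        exact h1.trans hadj.reachable
  · rw [scan_of_not_adj hadj]
    exact ⟨h1, h2⟩

theorem scan_eq_of_adj_iff {G H : SimpleGraph V} {x : Labeling V (k + 2) × Fin (k + 1)}
    (h : G.Adj (carrier x) (x.1.symm x.2.succ) ↔ H.Adj (carrier x) (x.1.symm x.2.succ)) :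
    scan G k x = scan H k x := by
  by_cases hG : G.Adj (carrier x) (x.1.symm x.2.succ)
  · rw [scan_of_adj hG, scan_of_adj (h.1 hG)]
  · rw [scan_of_not_adj hG, scan_of_not_adj (mt h.2 hG)]

/-! ### Promotion as a full round of scanning -/

theorem swap_trans_cycleRange {n j : ℕ} (hj : j + 1 < n + 1) :
    (Equiv.swap (⟨j, by omega⟩ : Fin (n + 1)) ⟨j + 1, hj⟩).trans
      (Fin.cycleRange ⟨j, by omega⟩) = Fin.cycleRange ⟨j + 1, hj⟩ := by
  ext i
  rw [Equiv.trans_apply]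
  rcases lt_trichotomy i.1 j with h | h | h
  · rw [Equiv.swap_apply_of_ne_of_ne (by simp [Fin.ext_iff]; omega) (by simp [Fin.ext_iff]; omega),
      Fin.coe_cycleRange_of_lt (by simpa [Fin.lt_def] using h),
      Fin.coe_cycleRange_of_lt (by simp [Fin.lt_def]; omega)]
  · rw [show i = ⟨j, by omega⟩ from Fin.ext h, Equiv.swap_apply_left,
      Fin.cycleRange_of_gt (by simp [Fin.lt_def]),
      Fin.coe_cycleRange_of_lt (by simp [Fin.lt_def])]
  · rcases (Nat.succ_le_of_lt h).eq_or_lt with h | h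
    · rw [show i = ⟨j + 1, hj⟩ from Fin.ext h.symm, Equiv.swap_apply_right,
        Fin.cycleRange_self, Fin.cycleRange_self]
    · rw [Equiv.swap_apply_of_ne_of_ne (by simp [Fin.ext_iff]; omega)
          (by simp [Fin.ext_iff]; omega),
        Fin.cycleRange_of_gt (by simp [Fin.lt_def]; omega),
        Fin.cycleRange_of_gt (by simp [Fin.lt_def]; omega)]

/-- The first `j` toggles of promotion amount to `j` scanning steps followed by moving the label
`0` up to `j` and the labels `1, …, j` down by one: toggling `j` and `j + 1` does nothing on
adjacent vertices, where the scan exchanges, and exchanges on nonadjacent ones, where the scan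
only passes by. -/
theorem prod_toggle_apply (G : SimpleGraph V) (σ : Labeling V (k + 2)) (j : ℕ) (hj : j < k + 2) :
    ((List.finRange j).map fun i =>
      toggle G (⟨i.1, by omega⟩ : Fin (k + 2)) (⟨i.1 + 1, by omega⟩ : Fin (k + 2))).reverse.prod σ
      = ((scan G k ^ j) (σ, 0)).1.trans (Fin.cycleRange ⟨j, hj⟩).symm := by
  induction j with
  | zero => ext; simp [Equiv.Perm.one_def]
  | succ j ih =>
    have ih := ih (by omega)
    rw [List.finRange_succ_last]
    simp only [List.map_append, List.map_map, List.reverse_append, List.map_cons, List.map_nil,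
      List.reverse_singleton, List.singleton_append, List.prod_cons, Equiv.Perm.mul_apply,
      Function.comp_def, Fin.val_castSucc, Fin.val_last]
    rw [ih, pow_succ', Equiv.Perm.mul_apply]
    set x := (scan G k ^ j) (σ, 0) with hxdef
    have hx2 : x.2 = ⟨j, by omega⟩ := by
      ext
      rw [hxdef, scan_pow_snd]
      simp; omega
    have hsucc : x.2.succ = ⟨j + 1, hj⟩ := by rw [hx2]; rfl
    have h0 : (Fin.cycleRange (⟨j, by omega⟩ : Fin (k + 2))) ⟨j, by omega⟩ = 0 := by
      simp
    have h1 : (Fin.cycleRange (⟨j, by omega⟩ : Fin (k + 2))) ⟨j + 1, hj⟩ = ⟨j + 1, hj⟩ :=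
      Fin.cycleRange_of_gt (by simp [Fin.lt_def])
    have hcyc : (Fin.cycleRange (⟨j, by omega⟩ : Fin (k + 2))).symm.trans
        (Equiv.swap ⟨j, by omega⟩ ⟨j + 1, hj⟩) = (Fin.cycleRange ⟨j + 1, hj⟩).symm := by
      rw [← swap_trans_cycleRange hj, Equiv.symm_trans, Equiv.symm_swap]
    by_cases hadj : G.Adj (carrier x) (x.1.symm x.2.succ)
    · rw [scan_of_adj hadj]
      have : toggle G (⟨j, by omega⟩ : Fin (k + 2)) ⟨j + 1, hj⟩
          (x.1.trans (Fin.cycleRange ⟨j, by omega⟩).symm) =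
          x.1.trans (Fin.cycleRange ⟨j, by omega⟩).symm := by
        rw [hsucc] at hadj
        simp [toggle, toggleFun, h0, h1, show G.Adj (x.1.symm 0) _ from hadj]
      rw [this, hsucc, ← hcyc, Equiv.trans_assoc]
      congr 1
      have h0' := (Equiv.symm_apply_eq _).2 h0.symm
      have h1' := (Equiv.symm_apply_eq _).2 h1.symm
      ext i
      simp only [Equiv.trans_apply]
      rw [(Fin.cycleRange _).symm.injective.map_swap, h0', h1', Equiv.swap_apply_self]
    · rw [scan_of_not_adj hadj, ← hcyc]
      rw [hsucc] at hadj
      simp [toggle, toggleFun, h0, h1, show ¬ G.Adj (x.1.symm 0) _ from hadj, Equiv.trans_assoc]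

/-- The cyclic shift undoes the relabeling left over by the full promotion. -/
theorem cyclicShift_mul_promotion_apply (G : SimpleGraph V) (σ : Labeling V (k + 2)) :
    (cyclicShift V (k + 2) * promotion G (k + 2)) σ = ((scan G k ^ (k + 1)) (σ, 0)).1 := by
  have h := prod_toggle_apply G σ (k + 1) (by omega)
  have hlast : Fin.cycleRange (⟨k + 1, by omega⟩ : Fin (k + 2)) = finRotate (k + 2) :=
    Fin.cycleRange_last (k + 1)
  rw [hlast] at h
  rw [Equiv.Perm.mul_apply]
  change (promotion G (k + 2) σ).trans (finRotate (k + 2)) = _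
  rw [show promotion G (k + 2) σ = _ from h, Equiv.trans_assoc, Equiv.symm_trans_self,
    Equiv.trans_refl]

/-- Rounds of `k + 1` scanning steps started at slot `0` iterate `c * Pro`. -/
theorem cyclicShift_mul_promotion_pow_apply (G : SimpleGraph V) (σ : Labeling V (k + 2)) (a : ℕ) :
    (scan G k ^ ((k + 1) * a)) (σ, 0) =
      (((cyclicShift V (k + 2) * promotion G (k + 2)) ^ a) σ, 0) := by
  have hone : ∀ τ : Labeling V (k + 2), (scan G k ^ (k + 1)) (τ, 0) =
      ((cyclicShift V (k + 2) * promotion G (k + 2)) τ, 0) := fun τ =>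
    Prod.ext (cyclicShift_mul_promotion_apply G τ).symm (Fin.ext (by rw [scan_pow_snd]; simp))
  induction a with
  | zero => simp
  | succ a ih => rw [Nat.mul_succ, add_comm ((k + 1) * a), pow_add, Equiv.Perm.mul_apply, ih, hone,
      pow_succ', Equiv.Perm.mul_apply (cyclicShift V (k + 2) * promotion G (k + 2))]

/-! ### Cycles of the scanning process -/

theorem reachable_iff_deleteEdges {G : SimpleGraph V} {p w : V} (h : G.Adj p w) (u : V) :
    G.Reachable p u ↔
      (G.deleteEdges {s(p, w)}).Reachable p u ∨ (G.deleteEdges {s(p, w)}).Reachable w u := by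
  have hle := G.deleteEdges_le {s(p, w)}
  constructor
  · rintro ⟨q⟩
    have key : ∀ {a b : V}, G.Walk a b →
        ((G.deleteEdges {s(p, w)}).Reachable p a ∨ (G.deleteEdges {s(p, w)}).Reachable w a) →
        ((G.deleteEdges {s(p, w)}).Reachable p b ∨ (G.deleteEdges {s(p, w)}).Reachable w b) := by
      intro a b q
      induction q with
      | nil => exact id
      | @cons a c b hac q ih =>
        intro ha
        apply ih
        by_cases he : s(a, c) = s(p, w)
        · rcases Sym2.eq_iff.1 he with ⟨-, rfl⟩ | ⟨-, rfl⟩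
          exacts [Or.inr (.refl _), Or.inl (.refl _)]
        · have hadj : (G.deleteEdges {s(p, w)}).Adj a c := by
            simpa [SimpleGraph.deleteEdges_adj] using ⟨hac, by simpa using he⟩
          exact ha.imp (·.trans hadj.reachable) (·.trans hadj.reachable)
    exact key q (Or.inl (.refl _))
  · rintro (hu | hu)
    exacts [hu.mono hle, h.reachable.trans (hu.mono hle)]

/-- Along the cycle of the scan through `x`, every pair of a vertex in the connected component of
the carrier and a slot occurs exactly once as a pair of carrier and pointer, and no other pair
occurs. -/
def VisitsOnce (G : SimpleGraph V) (x : Labeling V (k + 2) × Fin (k + 1)) : Prop :=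
  Set.BijOn (fun z => (carrier z, z.2)) {z | (scan G k).SameCycle x z}
    {a | G.Reachable (carrier x) a.1}

theorem VisitsOnce.congr {G : SimpleGraph V} {x z : Labeling V (k + 2) × Fin (k + 1)} [Finite V]
    (hz : (scan G k).SameCycle x z) (h : VisitsOnce G x) : VisitsOnce G z := by
  have hr := (scan_invariant hz).1
  have e1 : {y | (scan G k).SameCycle z y} = {y | (scan G k).SameCycle x y} :=
    Set.ext fun y => ⟨hz.trans, hz.symm.trans⟩
  have e2 : {a : V × Fin (k + 1) | G.Reachable (carrier z) a.1} =
      {a | G.Reachable (carrier x) a.1} :=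
    Set.ext fun a => ⟨hr.trans, hr.symm.trans⟩
  unfold VisitsOnce
  rwa [e1, e2]

/-- An isolated carrier never changes, so the pointer just runs once through all slots. -/
theorem visitsOnce_of_forall_not_adj [Finite V] {G : SimpleGraph V}
    {x : Labeling V (k + 2) × Fin (k + 1)} (hG : ∀ b, ¬ G.Adj (carrier x) b) :
    VisitsOnce G x := by
  have hreach : ∀ b, G.Reachable (carrier x) b → carrier x = b := by
    rintro b ⟨q⟩
    cases q with
    | nil => rfl
    | cons h _ => exact (hG _ h).elim
  have hfst : ∀ z, (scan G k).SameCycle x z → z.1 = x.1 := fun z hz => by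
    refine hz.mem_of_mapsTo (C := {z : Labeling V (k + 2) × Fin (k + 1) | z.1 = x.1})
      (fun a ha => ?_) rfl
    have hc : carrier a = carrier x := congrArg (fun σ : Labeling V (k + 2) => σ.symm 0) ha
    rw [scan_of_not_adj (by rw [hc]; exact hG _)]
    exact ha
  refine ⟨fun z hz => (scan_invariant hz).1, ?_, ?_⟩
  · intro a ha b hb hab
    exact Prod.ext ((hfst a ha).trans (hfst b hb).symm) (Prod.ext_iff.1 hab).2
  · rintro ⟨a, q⟩ ha
    obtain rfl := hreach _ ha
    have hs : (scan G k).SameCycle x ((scan G k ^ (q - x.2 : Fin (k + 1)).1) x) :=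
      ⟨_, by rw [zpow_natCast]⟩
    refine ⟨_, hs, Prod.ext ?_ ?_⟩
    · change ((scan G k ^ (q - x.2 : Fin (k + 1)).1) x).1.symm 0 = _
      rw [hfst _ hs]; rfl
    · ext
      rw [scan_pow_snd, ← Fin.val_add]
      simp

/-- Restoring a deleted bridge `p w`: the cycle of states carried in the component of `p` has
exactly one state `x` in which `p` inspects the slot of `w`. With the edge restored, this state and
the state `y` obtained by exchanging `p` and `w` trade successors, so the cycles through `x` and
`y` are merged. -/
theorem VisitsOnce.of_deleteEdges [Finite V] {G : SimpleGraph V} {p w : V} (hadj : G.Adj p w)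
    (hbridge : ¬ (G.deleteEdges {s(p, w)}).Reachable p w)
    (ih : ∀ x : Labeling V (k + 2) × Fin (k + 1), VisitsOnce (G.deleteEdges {s(p, w)}) x)
    {z : Labeling V (k + 2) × Fin (k + 1)}
    (hz : (G.deleteEdges {s(p, w)}).Reachable p (carrier z)) : VisitsOnce G z := by
  set H := G.deleteEdges {s(p, w)} with hH
  have hHadj : ∀ a b, H.Adj a b ↔ G.Adj a b ∧ s(a, b) ≠ s(p, w) := by
    intro a b; simp [hH, SimpleGraph.deleteEdges_adj]
  -- `w` lies outside the component of the carrier, so it occupies some slot `q`.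
  have hw0 : z.1 w ≠ 0 := by
    intro h
    rw [← Equiv.eq_symm_apply] at h
    rw [h] at hbridge
    exact hbridge hz
  obtain ⟨q, hq⟩ := Fin.exists_succ_eq.2 hw0
  obtain ⟨x, hzx, hxκ⟩ :=
    (ih z).surjOn (show (p, q) ∈ {a | H.Reachable (carrier z) a.1} from hz.symm)
  obtain ⟨hxp, hxq⟩ := Prod.ext_iff.1 hxκ
  simp only at hxp hxq
  -- `w` waits at slot `q` as long as the carrier stays in the component of `p`.
  have hwait : ∀ a, H.Reachable p (carrier a) → ∀ b, (scan H k).SameCycle a b → b.1 w = a.1 w :=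
    fun a ha b hab => (scan_invariant hab).2 w fun h => hbridge (ha.trans h)
  have hxw : x.1 w = x.2.succ := by rw [hwait z hz x hzx, ← hq, hxq]
  set y : Labeling V (k + 2) × Fin (k + 1) := (x.1.trans (Equiv.swap 0 x.2.succ), x.2) with hy
  have hxw' : x.1.symm x.2.succ = w := by rw [Equiv.symm_apply_eq, hxw]
  have hyw : carrier y = w := by simp [hy, carrier, hxw']
  have hyp' : y.1.symm y.2.succ = p := by simp [hy, ← hxp, carrier]
  have hyp : y.1 p = y.2.succ := by rw [← hyp', Equiv.apply_symm_apply]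
  have hwait' : ∀ b, (scan H k).SameCycle y b → b.1 p = y.1 p :=
    fun b hb => (scan_invariant hb).2 p fun h => hbridge (by rw [hyw] at h; exact h.symm)
  have hnx : ¬ H.Adj (carrier x) (x.1.symm x.2.succ) := by rw [hxp, hxw', hHadj]; simp
  have hny : ¬ H.Adj (carrier y) (y.1.symm y.2.succ) := by
    rw [hyw, hyp', hHadj]; simp [Sym2.eq_swap]
  have hGx : G.Adj (carrier x) (x.1.symm x.2.succ) := by rwa [hxp, hxw']
  have hGy : G.Adj (carrier y) (y.1.symm y.2.succ) := by rw [hyw, hyp']; exact hadj.symm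
  have hGH : ∀ b : Labeling V (k + 2) × Fin (k + 1),
      s(carrier b, b.1.symm b.2.succ) ≠ s(p, w) → scan G k b = scan H k b :=
    fun b hb => scan_eq_of_adj_iff (by simp [hHadj, hb])
  have hyx : ¬ (scan H k).SameCycle y x := fun h => by
    have := (scan_invariant h).1
    rw [hyw, hxp] at this
    exact hbridge this.symm
  have hunion := setOf_sameCycle_eq_union (f := scan H k) (g := scan G k)
    (by rw [scan_of_adj hGx, scan_of_not_adj hny])
    (by
      rw [scan_of_adj hGy, scan_of_not_adj hnx]
      refine Prod.ext (Equiv.ext fun v => ?_) rfl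
      simp [hy])
    (by
      intro b hb hbx
      apply hGH
      intro he
      have hr := (scan_invariant hb).1
      rw [hxp] at hr
      rcases Sym2.eq_iff.1 he with ⟨h1, h2⟩ | ⟨h1, -⟩
      · apply hbx
        refine (ih x).injOn hb (Equiv.Perm.SameCycle.refl _ _) (Prod.ext (h1.trans hxp.symm) ?_)
        apply Fin.succ_injective
        rw [Equiv.symm_apply_eq] at h2
        rw [h2, hwait x (by rw [hxp]) b hb, hxw]
      · rw [h1] at hr
        exact hbridge hr)
    (by
      intro b hb hby
      apply hGH
      intro he
      have hr := (scan_invariant hb).1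
      rw [hyw] at hr
      rcases Sym2.eq_iff.1 he with ⟨h1, -⟩ | ⟨h1, h2⟩
      · rw [h1] at hr
        exact hbridge hr.symm
      · apply hby
        refine (ih y).injOn hb (Equiv.Perm.SameCycle.refl _ _) (Prod.ext (h1.trans hyw.symm) ?_)
        apply Fin.succ_injective
        rw [Equiv.symm_apply_eq] at h2
        rw [h2, hwait' b hb, hyp])
  have hcomp : {a : V × Fin (k + 1) | G.Reachable (carrier x) a.1} =
      {a | H.Reachable (carrier x) a.1} ∪ {a | H.Reachable (carrier y) a.1} := by
    ext a
    rw [hxp, hyw]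
    exact reachable_iff_deleteEdges hadj a.1
  have hx : VisitsOnce G x := by
    unfold VisitsOnce
    rw [hunion, hcomp]
    refine (ih x).union (ih y) ?_
    rw [Set.injOn_union]
    · refine ⟨(ih x).injOn, (ih y).injOn, fun a ha b hb hab => ?_⟩
      have h1 := (scan_invariant ha).1
      have h2 := (scan_invariant hb).1
      rw [hxp] at h1
      rw [hyw, ← show carrier a = carrier b from (Prod.ext_iff.1 hab).1] at h2
      exact hbridge (h1.trans h2.symm)
    · rw [Set.disjoint_left]
      exact fun a ha hb => hyx (hb.trans ha.symm)
  refine hx.congr ?_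
  have : z ∈ {z | (scan G k).SameCycle x z} := by rw [hunion]; exact Or.inl hzx.symm
  exact this

/-- Induction on the edges: deleting an edge at the carrier of a forest splits its component. -/
theorem visitsOnce_of_isAcyclic [Finite V] (G : SimpleGraph V) (hG : G.IsAcyclic)
    (x : Labeling V (k + 2) × Fin (k + 1)) : VisitsOnce G x := by
  induction G using WellFoundedLT.induction generalizing x with
  | ind G ih =>
    by_cases hisol : ∀ b, ¬ G.Adj (carrier x) b
    · exact visitsOnce_of_forall_not_adj hisol
    push Not at hisol
    obtain ⟨w, hadj⟩ := hisol
    have hbridge : ¬ (G.deleteEdges {s(carrier x, w)}).Reachable (carrier x) w :=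
      SimpleGraph.isBridge_iff.1 (SimpleGraph.isAcyclic_iff_forall_adj_isBridge.1 hG hadj)
    have hle := G.deleteEdges_le {s(carrier x, w)}
    have hlt : G.deleteEdges {s(carrier x, w)} < G :=
      lt_of_le_of_ne hle fun h => hbridge (by rw [h]; exact hadj.reachable)
    exact VisitsOnce.of_deleteEdges hadj hbridge (fun y => ih _ hlt (hG.anti hle) y) (.refl _)

/-- The states with pointer `0` on the cycle of the scan through `(σ, 0)` are the labelings in the
orbit of `c * Pro`, and there is exactly one of them for each carrier. -/
theorem bijOn_carrier_of_isTree [Finite V] {G : SimpleGraph V} (hG : G.IsTree)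
    (σ : Labeling V (k + 2)) :
    Set.BijOn (fun τ : Labeling V (k + 2) => τ.symm 0)
      (MulAction.orbit (Subgroup.zpowers (cyclicShift V (k + 2) * promotion G (k + 2))) σ)
      Set.univ := by
  set R := cyclicShift V (k + 2) * promotion G (k + 2) with hR
  have hpow : ∀ (τ : Labeling V (k + 2)) (a : ℕ),
      (scan G k ^ ((k + 1) * a)) (τ, 0) = ((R ^ a) τ, 0) :=
    cyclicShift_mul_promotion_pow_apply G
  have hmem : ∀ τ, τ ∈ MulAction.orbit (Subgroup.zpowers R) σ ↔ R.SameCycle σ τ := by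
    intro τ
    simp [MulAction.mem_orbit_iff, Subgroup.exists_zpowers, Equiv.Perm.SameCycle, Subgroup.smul_def]
  have horb : ∀ τ, R.SameCycle σ τ → (scan G k).SameCycle (σ, 0) (τ, 0) := by
    intro τ h
    obtain ⟨a, rfl⟩ := h.exists_nat_pow_eq
    exact ⟨((k + 1) * a : ℕ), by rw [zpow_natCast, hpow]⟩
  have hbij := visitsOnce_of_isAcyclic G hG.isAcyclic ((σ, 0) : Labeling V (k + 2) × Fin (k + 1))
  refine ⟨Set.mapsTo_univ _ _, fun τ hτ τ' hτ' h => ?_, fun v _ => ?_⟩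
  · exact (Prod.ext_iff.1 (hbij.injOn (horb τ ((hmem τ).1 hτ)) (horb τ' ((hmem τ').1 hτ'))
      (Prod.ext h rfl))).1
  · obtain ⟨z, hz, hzv⟩ := hbij.surjOn (show (v, (0 : Fin (k + 1))) ∈ _ from hG.connected _ v)
    obtain ⟨h1, h2⟩ := Prod.ext_iff.1 hzv
    obtain ⟨j, rfl⟩ := Equiv.Perm.SameCycle.exists_nat_pow_eq hz
    have hdvd : k + 1 ∣ j := by
      have := scan_pow_snd G ((σ, 0) : Labeling V (k + 2) × Fin (k + 1)) j
      simp only at h2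
      rw [h2] at this
      simpa [Nat.dvd_iff_mod_eq_zero] using this.symm
    obtain ⟨a, rfl⟩ := hdvd
    refine ⟨(R ^ a) σ, (hmem _).2 ⟨a, by rw [zpow_natCast]⟩, ?_⟩
    rw [hpow] at h1
    exact h1

end Scan

theorem corollary3p7 {V : Type*} [Fintype V] (G : SimpleGraph V) (n : ℕ)
    (hn : Fintype.card V = n) (hG : G.IsTree) (σ : Labeling V n) :
    (MulAction.orbit (Subgroup.zpowers (cyclicShift V n * promotion G n)) σ).ncard = n := by
  match n with
  | 0 =>
    obtain ⟨v⟩ := hG.connected.nonempty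
    exact (σ v).elim0
  | 1 =>
    have : Subsingleton (Labeling V 1) := ⟨fun a b => Equiv.ext fun v => Subsingleton.elim _ _⟩
    rw [Set.ncard_eq_one]
    exact ⟨σ, Set.eq_singleton_iff_unique_mem.2
      ⟨MulAction.mem_orbit_self σ, fun τ _ => Subsingleton.elim τ σ⟩⟩
  | k + 2 =>
    have h := bijOn_carrier_of_isTree hG σ
    rw [← h.injOn.ncard_image, h.image_eq, Set.ncard_univ, Nat.card_eq_fintype_card, hn]
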